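/- **Setting.** Let $G=(\mathcal V,\mathcal E)$ be a directed graph with a finite node set $\mathcal V$ and $\mathcal E\subseteq\mathcal V\times\mathcal V$. Each edge $e\in\mathcal E$ carries a channel with finite input alphabet $\mathsf X_e$, finite output alphabet $\mathsf Y_e$ and stochastic transition law $K_e$. Let $W=(W_v)_{v\in\mathcal V}$ be arbitrarily jointly distributed random variables, $W_v$ taking values in a standard Borel space $\mathsf W_v$, and let $Z=f(W)$, where $f:\prod_v\mathsf W_v\to\mathsf Z$ is measurable and $\mathsf Z$ is standard Borel. For an integer $T\ge 0$, a *$T$-step algorithm* consists of measurable encoders $\varphi_{v,t}:\mathsf W_v\times\mathsf Y_{v\leftarrow}^{t-1}\to\mathsf X_{v\to}$ and estimators $\psi_v:\mathsf W_v\times\mathsf Y_{v\leftarrow}^{T}\to\mathsf Z$ ($v\in\mathcal V$, $1\le t\le T$), where $\mathsf X_{v\to}=\prod_{(v,u)\in\mathcal E}\mathsf X_{(v,u)}$ and $\mathsf Y_{v\leftarrow}=\prod_{(u,v)\in\mathcal E}\mathsf Y_{(u,v)}$. At each time $t$ every node $v$ sends $X_{v,t}=\varphi_{v,t}(W_v,Y_v^{t-1})$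 over its outgoing edges. Given $W$, all channel inputs up to time $t$ and all channel outputs before time $t$, the outputs at time $t$ are drawn from $\bigotimes_{e\in\mathcal E}K_e$ applied to the inputs at time $t$; $Y_{v,t}$ denotes the outputs of the edges entering $v$. After $T$ steps node $v$ forms the estimate $\widehat Z_v=\psi_v(W_v,Y_v^T)$. For a channel $K$ define the SDPI constant $$\eta(K)=\sup_{P_X}\ \sup_{Q_X\ne P_X}\frac{D(Q_Y\|P_Y)}{D(Q_X\|P_X)}\in[0,1],$$ where $P_X,Q_X$ range over input distributions with $D(Q_X\|P_X)<\infty$, and $P_Y,Q_Y$ are the corresponding output distributions (the supremum of the empty set is $0$). For $v\in\mathcal V$ let $\mathcal E_v=\{(u,v)\in\mathcal E: u\ne v\}$, $K_v=\bigotimes_{e\in\mathcal E_v}K_e$, $\eta_v=\eta(K_v)$, and $\eta_v^*=\max_{e\in\mathcal E_v}\eta(K_e)$ ($\eta_v^*=0$ if $\mathcal E_v=\varnothing$). For $\mathcal S\subseteq\mathcal V$ write $W_{\mathcal S}=(W_u)_{u\in\mathcal S}$ and $\mathcal S^c=\mathcal V\setminus\mathcal S$. **Lemma (SDPI upper bound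 on conditional mutual information).** For every set $\mathcal S\subseteq\mathcal V$, every node $v\in\mathcal S$, every $T\ge 0$ and every $T$-step algorithm, $$I(Z;\widehat Z_v\mid W_{\mathcal S})\ \le\ \bigl(1-(1-\eta_v)^{T}\bigr)\,H(W_{\mathcal S^c}\mid W_{\mathcal S})\ \le\ \bigl(1-(1-\eta_v^*)^{|\mathcal E_v|\,T}\bigr)\,H(W_{\mathcal S^c}\mid W_{\mathcal S}).$$ Here $I$ and $H$ are the conditional mutual information and the conditional (Shannon) entropy in bits, with values in $[0,\infty]$; $H(W_{\mathcal S^c}\mid W_{\mathcal S})=\infty$ if, with positive probability, the conditional law of $W_{\mathcal S^c}$ given $W_{\mathcal S}$ is not discrete. Conventions: $0\cdot\infty=0$ and $0^0=1$. -/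

import Mathlib

open MeasureTheory ProbabilityTheory
open scoped ENNReal

namespace DistComp

noncomputable section

/-! ### Information measures

All quantities take values in `[0, ∞]`, and mutual information and entropy are measured in bits.
-/

/-- Shannon entropy, in bits, of a probability law `ν`: the expectation of `-log₂ ν{x}` under `x ∼ ν`.
For a law carried by a countable set it is `∑ x, ν{x} log₂ (1 / ν{x})`; it is `∞` for a law that is not
carried by a countable set. -/
def entropy {α : Type*} [MeasurableSpace α] (ν : Measure α) : ℝ≥0∞ :=
  ∫⁻ x, (-(ENNReal.log (ν {x}))).toENNReal / ENNReal.ofReal (Real.log 2) ∂ν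

/-- Conditional entropy `H(A | C)`: the average, over the law of `C`, of the entropy of the
conditional law of `A` given `C = c`. -/
def condEntropy {Ω α γ : Type*} [MeasurableSpace Ω] [MeasurableSpace α] [StandardBorelSpace α]
    [Nonempty α] [MeasurableSpace γ] (A : Ω → α) (C : Ω → γ) (μ : Measure Ω) [IsFiniteMeasure μ] :
    ℝ≥0∞ :=
  ∫⁻ c, entropy (condDistrib A C μ c) ∂(μ.map C)

/-- Conditional mutual information `I(A ; B | C)`, in bits: the relative entropy of the joint law of
`(C, (A, B))` with respect to the law under which `C` has the same distribution and `A` and `B` are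
conditionally independent given `C` with the same conditional laws given `C`. -/
def condMutualInfo {Ω α β γ : Type*} [MeasurableSpace Ω]
    [MeasurableSpace α] [StandardBorelSpace α] [Nonempty α]
    [MeasurableSpace β] [StandardBorelSpace β] [Nonempty β] [MeasurableSpace γ]
    (A : Ω → α) (B : Ω → β) (C : Ω → γ) (μ : Measure Ω) [IsFiniteMeasure μ] : ℝ≥0∞ :=
  InformationTheory.klDiv (μ.map fun ω => (C ω, (A ω, B ω)))
      (Measure.compProd (μ.map C) (Kernel.prod (condDistrib A C μ) (condDistrib B C μ))) /
    ENNReal.ofReal (Real.log 2)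

/-! ### Channels and strong data processing constants -/

/-- The SDPI constant of a channel `K`: the supremum of `D(Q_Y ‖ P_Y) / D(Q_X ‖ P_X)` over all pairs of
distinct input distributions `P_X`, `Q_X`, where `P_Y`, `Q_Y` are the corresponding output
distributions. A pair with `D(Q_X ‖ P_X) = ∞` imposes no constraint. A supremum over no pair is `0`. -/
def sdpiConst {X Y : Type*} [MeasurableSpace X] [MeasurableSpace Y] (K : Kernel X Y) : ℝ≥0∞ :=
  ⨆ (P : Measure X) (Q : Measure X) (_ : IsProbabilityMeasure P) (_ : IsProbabilityMeasure Q)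
    (_ : Q ≠ P) (_ : InformationTheory.klDiv Q P ≠ ∞),
    InformationTheory.klDiv (Q.bind K) (P.bind K) / InformationTheory.klDiv Q P

/-- SDPI constants never exceed `1`, so that `1 - sdpiConst K` in `[0, ∞]` is a true difference. -/
theorem sdpiConst_le_one {X Y : Type*} [MeasurableSpace X] [MeasurableSpace Y] (K : Kernel X Y)
    [IsMarkovKernel K] : sdpiConst K ≤ 1 := by
  refine iSup_le fun P => iSup_le fun Q => iSup_le fun hP => iSup_le fun hQ => iSup_le fun _ =>
    iSup_le fun _ => ?_
  exact ENNReal.div_le_of_le_mul (by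
    rw [one_mul]; exact InformationTheory.klDiv_comp_right_le Q P K)

/-- The tensor product of finitely many channels with finite input alphabets. -/
def prodChannel {ι : Type*} [Fintype ι] {X Y : ι → Type*}
    [∀ i, Finite (X i)] [∀ i, MeasurableSpace (X i)] [∀ i, MeasurableSingletonClass (X i)]
    [∀ i, MeasurableSpace (Y i)] (K : ∀ i, Kernel (X i) (Y i)) :
    Kernel (∀ i, X i) (∀ i, Y i) :=
  Kernel.ofFunOfCountable fun x => Measure.pi fun i => K i (x i)

instance {ι : Type*} [Fintype ι] {X Y : ι → Type*}
    [∀ i, Finite (X i)] [∀ i, MeasurableSpace (X i)] [∀ i, MeasurableSingletonClass (X i)]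
    [∀ i, MeasurableSpace (Y i)] (K : ∀ i, Kernel (X i) (Y i)) [∀ i, IsMarkovKernel (K i)] :
    IsMarkovKernel (prodChannel K) :=
  ⟨fun x => by
    change IsProbabilityMeasure (Measure.pi fun i => K i (x i))
    infer_instance⟩

/-! ### Networks and algorithms

A network on the node set `V` has a finite set `E` of directed edges `(u, v)` (from `u` to `v`), and
alphabets `X e`, `Y e` and a channel `K e` for each edge `e`.
-/

variable {V : Type*}

/-- The cutset of `S`: the edges that go from a node outside `S` to a node in `S`. -/
abbrev Cutset [DecidableEq V] (E : Finset (V × V)) (S : Finset V) : Type _ :=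
  {e : E // e.1.1 ∉ S ∧ e.1.2 ∈ S}

/-- The channel `⨂ K e`, over the edges `e` of the cutset of `S`. -/
abbrev cutsetChannel [DecidableEq V] {E : Finset (V × V)} {X Y : E → Type*}
    [∀ e, Finite (X e)] [∀ e, MeasurableSpace (X e)] [∀ e, MeasurableSingletonClass (X e)]
    [∀ e, MeasurableSpace (Y e)] (K : ∀ e, Kernel (X e) (Y e)) (S : Finset V) :
    Kernel (∀ e : Cutset E S, X e.1) (∀ e : Cutset E S, Y e.1) :=
  prodChannel fun e : Cutset E S => K e.1

/-- Messages sent by node `v` in one time step, one on each outgoing edge. -/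
abbrev OutMsg {E : Finset (V × V)} (X : E → Type*) (v : V) : Type _ :=
  ∀ e : {e : E // e.1.1 = v}, X e.1

/-- Messages received by node `v` in one time step, one on each incoming edge. -/
abbrev InMsg {E : Finset (V × V)} (Y : E → Type*) (v : V) : Type _ :=
  ∀ e : {e : E // e.1.2 = v}, Y e.1

/-- The part of a history of channel outputs that node `v` has received. -/
def received {E : Finset (V × V)} {Y : E → Type*} {t : ℕ} (v : V) (y : Fin t → ∀ e, Y e) :
    Fin t → InMsg Y v :=
  fun s e => y s e.1

/-- A `T`-step algorithm: deterministic encoders, which map the local observation of a node and the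
messages it received before to the messages that it sends next, and deterministic estimators, which
map the local observation and all received messages to the final estimate. The time steps
`1, …, T` are numbered `0, …, T - 1`. -/
structure Algorithm (E : Finset (V × V)) (W : V → Type*) (X Y : E → Type*) (Z : Type*) (T : ℕ)
    [∀ v, MeasurableSpace (W v)] [∀ e, MeasurableSpace (X e)] [∀ e, MeasurableSpace (Y e)]
    [MeasurableSpace Z] where
  encode : ∀ (v : V) (t : Fin T), W v × (Fin t → InMsg Y v) → OutMsg X v
  estimate : ∀ v : V, W v × (Fin T → InMsg Y v) → Z
  measurable_encode : ∀ v t, Measurable (encode v t)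
  measurable_estimate : ∀ v, Measurable (estimate v)

namespace Algorithm

variable {E : Finset (V × V)} {W : V → Type*} {X Y : E → Type*} {Z : Type*} {T : ℕ}
  [∀ v, MeasurableSpace (W v)] [∀ e, MeasurableSpace (X e)] [∀ e, MeasurableSpace (Y e)]
  [MeasurableSpace Z]

/-- The channel inputs on all the edges at time `t`, as a function of all local observations and of the
channel outputs at the earlier times. -/
def inputs (A : Algorithm E W X Y Z T) (t : ℕ) (h : t < T) (p : (∀ v, W v) × (Fin t → ∀ e, Y e)) :
    ∀ e, X e :=
  fun e => A.encode e.1.1 ⟨t, h⟩ (p.1 e.1.1, received e.1.1 p.2) ⟨e, rfl⟩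

theorem measurable_received {t : ℕ} (v : V) :
    Measurable (received v : (Fin t → ∀ e, Y e) → Fin t → InMsg Y v) := by
  unfold received
  fun_prop

theorem measurable_inputs (A : Algorithm E W X Y Z T) (t : ℕ) (h : t < T) :
    Measurable (A.inputs t h) := by
  refine measurable_pi_lambda _ fun e => ?_
  have hm : Measurable fun p : (∀ v, W v) × (Fin t → ∀ e, Y e) =>
      A.encode e.1.1 ⟨t, h⟩ (p.1 e.1.1, received e.1.1 p.2) :=
    (A.measurable_encode e.1.1 ⟨t, h⟩).comp (((measurable_pi_apply e.1.1).comp measurable_fst).prodMk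
      ((measurable_received e.1.1).comp measurable_snd))
  exact (measurable_pi_apply (⟨e, rfl⟩ : {e' : E // e'.1.1 = e.1.1})).comp hm

theorem measurable_snoc {β : Type*} [MeasurableSpace β] (t : ℕ) :
    Measurable fun p : (Fin t → β) × β => (Fin.snoc p.1 p.2 : Fin (t + 1) → β) := by
  refine measurable_pi_lambda _ fun i => ?_
  refine Fin.lastCases ?_ (fun j => ?_) i
  · simpa using measurable_snd
  · simpa [Function.comp_def] using (measurable_pi_apply j).comp measurable_fst

variable [∀ e, Finite (X e)] [∀ e, MeasurableSingletonClass (X e)]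

/-- The conditional law of the channel outputs at time `t`, given all observations and all earlier
channel outputs: the current inputs are passed through the memoryless product channel. -/
def step (A : Algorithm E W X Y Z T) (K : ∀ e, Kernel (X e) (Y e)) (t : ℕ) (h : t < T) :
    Kernel ((∀ v, W v) × (Fin t → ∀ e, Y e)) (∀ e, Y e) :=
  (prodChannel K).comap (A.inputs t h) (A.measurable_inputs t h)

instance (A : Algorithm E W X Y Z T) (K : ∀ e, Kernel (X e) (Y e)) [∀ e, IsMarkovKernel (K e)]
    (t : ℕ) (h : t < T) : IsMarkovKernel (A.step K t h) := by
  unfold step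
  infer_instance

/-- The conditional law of the channel outputs of the first `t` time steps, given the observations. -/
def outputs (A : Algorithm E W X Y Z T) (K : ∀ e, Kernel (X e) (Y e)) :
    ∀ t : ℕ, t ≤ T → Kernel (∀ v, W v) (Fin t → ∀ e, Y e)
  | 0, _ => Kernel.const _ (Measure.dirac fun i => i.elim0)
  | t + 1, h =>
    (Kernel.compProd (A.outputs K t (Nat.le_of_succ_le h)) (A.step K t h)).map
      fun p => Fin.snoc p.1 p.2

instance isMarkovKernel_outputs (A : Algorithm E W X Y Z T) (K : ∀ e, Kernel (X e) (Y e))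
    [∀ e, IsMarkovKernel (K e)] (t : ℕ) (h : t ≤ T) : IsMarkovKernel (A.outputs K t h) := by
  induction t with
  | zero => unfold outputs; infer_instance
  | succ t ih =>
    have := ih (Nat.le_of_succ_le h)
    unfold outputs
    exact Kernel.IsMarkovKernel.map _ (measurable_snoc t)

/-- The joint law of the observations and of all the channel outputs of a run of the algorithm, when the
observations have joint law `PW`. -/
def law (A : Algorithm E W X Y Z T) (K : ∀ e, Kernel (X e) (Y e)) (PW : Measure (∀ v, W v)) :
    Measure ((∀ v, W v) × (Fin T → ∀ e, Y e)) :=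
  Measure.compProd PW (A.outputs K T le_rfl)

instance (A : Algorithm E W X Y Z T) (K : ∀ e, Kernel (X e) (Y e)) [∀ e, IsMarkovKernel (K e)]
    (PW : Measure (∀ v, W v)) [IsProbabilityMeasure PW] : IsProbabilityMeasure (A.law K PW) := by
  unfold law
  infer_instance

/-- The final estimate of node `v`. -/
def finalEstimate (A : Algorithm E W X Y Z T) (v : V)
    (ω : (∀ v, W v) × (Fin T → ∀ e, Y e)) : Z :=
  A.estimate v (ω.1 v, received v ω.2)

end Algorithm

/-- The observations of the nodes in `S`. -/
def observations {W : V → Type*} {Ω' : Type*} (S : Finset V) (ω : (∀ v, W v) × Ω') :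
    ∀ u : S, W u :=
  fun u => ω.1 u

end

end DistComp

open DistComp

/-! Fix `W_S = c`; since `v ∈ S`, this fixes `W_v`. Let `ν` be the conditional law of the remaining
observations, and let `d_t` be the relative entropy between the law of the history of `v` after `t`
steps when these equal `a`, and its `ν`-average. In one step, `v` learns something new only through
the channel `K_v`: the input of a self-loop is a function of `W_v` and the history, so its output
can be simulated locally. The chain rule (history first, then the inputs of `K_v`) and the SDPI
conditionally on the history give `d_{t+1} ≤ (1 - η_v) d_t + η_v D`, where `D = D(δ_a ‖ ν) = log (1
/ ν{a})` bounds, by data processing, the relative entropy of history and inputs together. As `d_0 =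
0`, `d_T ≤ (1 - (1 - η_v)^T) D`. Averaging `D` over `a` and `c` produces the conditional entropy,
while the average of `d_T` dominates `I(Z; Ẑ_v | W_S)` by data processing.

The one-step contraction is `klDiv_parallelComp_le`, its iteration `klDiv_bind_historyKernel_le`,
and the averaging `condMutualInfo_le_lintegral`. The second inequality is
`sdpiConst_prodChannel_le`, which runs the same recursion over the edges instead of over time:
useless channels are replaced by the true ones, one at a time. -/

namespace DistComp

open InformationTheory

/-! ### Relative entropy -/

section KL

variable {α β : Type*} [MeasurableSpace α] [MeasurableSpace β]

/-- Relative entropy of two composition-products with the same first factor: the average of the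
relative entropies of the kernels. -/
theorem klDiv_compProd_eq_lintegral [MeasurableSpace.CountableOrCountablyGenerated α β]
    (μ : Measure α) [IsFiniteMeasure μ] (κ η : Kernel α β) [IsFiniteKernel κ] [IsFiniteKernel η]
    (h : ∀ᵐ a ∂μ, κ a ≪ η a) :
    klDiv (μ ⊗ₘ κ) (μ ⊗ₘ η) = ∫⁻ a, klDiv (κ a) (η a) ∂μ := by
  have hκ : μ ⊗ₘ κ = (μ ⊗ₘ η).withDensity fun p => κ.rnDeriv η p.1 p.2 := by
    rw [← Measure.compProd_withDensity (κ := η) (f := κ.rnDeriv η) (Kernel.measurable_rnDeriv κ η)]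
    refine Measure.compProd_congr ?_
    filter_upwards [h] with a ha
    exact (Kernel.withDensity_rnDeriv_eq ha).symm
  have hd := Measure.rnDeriv_withDensity (μ ⊗ₘ η) (Kernel.measurable_rnDeriv κ η)
  rw [← hκ] at hd
  -- `klFun` is nonnegative, so Tonelli applies and infinite values need no separate treatment.
  rw [klDiv_eq_lintegral_klFun_of_ac (Measure.AbsolutelyContinuous.compProd_right h)]
  rw [lintegral_congr_ae (g := fun p => ENNReal.ofReal (klFun (κ.rnDeriv η p.1 p.2).toReal))
    (by filter_upwards [hd] with p hp; rw [hp])]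
  rw [Measure.lintegral_compProd]
  · refine lintegral_congr_ae ?_
    filter_upwards [h] with a ha
    rw [klDiv_eq_lintegral_klFun_of_ac ha]
    refine lintegral_congr_ae ?_
    filter_upwards [Kernel.rnDeriv_eq_rnDeriv_measure (κ := κ) (η := η) (a := a)] with b hb
    rw [hb]
  · exact (measurable_klFun.comp (Kernel.measurable_rnDeriv κ η).ennreal_toReal).ennreal_ofReal

theorem klDiv_bind_le_sdpiConst_mul (K : Kernel α β) [IsMarkovKernel K] {P Q : Measure α}
    [IsProbabilityMeasure P] [IsProbabilityMeasure Q] (h : klDiv Q P ≠ ∞) :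
    klDiv (Q.bind K) (P.bind K) ≤ sdpiConst K * klDiv Q P := by
  by_cases hQP : Q = P
  · subst hQP
    simp
  have h0 : klDiv Q P ≠ 0 := by rwa [Ne, klDiv_eq_zero_iff]
  rw [← ENNReal.div_le_iff h0 h]
  exact le_iSup_of_le P <| le_iSup_of_le Q <| le_iSup_of_le inferInstance <|
    le_iSup_of_le inferInstance <| le_iSup_of_le hQP <| le_iSup_of_le h le_rfl

/-- On a finite alphabet every log-likelihood ratio is integrable. This supplies the finiteness
required of the pairs in the supremum `sdpiConst`. -/
theorem klDiv_ne_top_of_finite [Finite α] [MeasurableSingletonClass α] {P Q : Measure α}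
    [IsFiniteMeasure P] [IsFiniteMeasure Q] (h : Q ≪ P) : klDiv Q P ≠ ∞ :=
  klDiv_ne_top h .of_finite

/-- A letter of mass zero under the mixture has mass zero under almost every component, and there
are only countably many letters. -/
theorem ae_absolutelyContinuous_bind [Countable β] [MeasurableSingletonClass β] (μ : Measure α)
    (N : Kernel α β) : ∀ᵐ a ∂μ, N a ≪ μ.bind N := by
  have h : ∀ᵐ a ∂μ, ∀ b, μ.bind N {b} = 0 → N a {b} = 0 := by
    rw [ae_all_iff]
    intro b
    by_cases hb : μ.bind N {b} = 0
    · rw [Measure.bind_apply (measurableSet_singleton b) N.aemeasurable,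
        lintegral_eq_zero_iff (N.measurable_coe (measurableSet_singleton b))] at hb
      filter_upwards [hb] with a ha _ using ha
    · exact .of_forall fun a h => absurd h hb
  filter_upwards [h] with a ha s hs
  rw [← Set.biUnion_of_singleton s, measure_biUnion_null_iff s.to_countable]
  exact fun b hb => ha b (measure_mono_null (Set.singleton_subset_iff.2 hb) hs)

/-- The source of the entropy term: the density of the point mass is `(ρ {a})⁻¹` at `a`. When `ρ {a}
= 0` the bound is infinite, which covers non-discrete laws. -/
theorem klDiv_dirac_le_neg_log [MeasurableSingletonClass α] (ρ : Measure α)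
    [IsProbabilityMeasure ρ] (a : α) :
    klDiv (Measure.dirac a) ρ ≤ (-(ENNReal.log (ρ {a}))).toENNReal := by
  by_cases h0 : ρ {a} = 0
  · simp [h0]
  have hd : Measure.dirac a = ρ.withDensity (Set.indicator {a} fun _ => (ρ {a})⁻¹) := by
    rw [withDensity_indicator (measurableSet_singleton a), withDensity_const,
      Measure.restrict_singleton, smul_smul, ENNReal.inv_mul_cancel h0 (measure_ne_top _ _),
      one_smul]
  have hm : Measurable (Set.indicator {a} fun _ : α => (ρ {a})⁻¹) :=
    measurable_const.indicator (measurableSet_singleton a)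
  have hr := Measure.rnDeriv_withDensity ρ hm
  rw [← hd] at hr
  have hac : Measure.dirac a ≪ ρ := hd ▸ withDensity_absolutelyContinuous _ _
  have hra : (Measure.dirac a).rnDeriv ρ a = (ρ {a})⁻¹ := by
    have := hac.ae_le hr
    rw [ae_dirac_eq] at this
    simpa using this
  have hint : Integrable (llr (Measure.dirac a) ρ) (Measure.dirac a) := by
    exact integrable_dirac (by simp)
  rw [klDiv_of_ac_of_integrable hac hint, integral_dirac]
  simp only [llr, hra, probReal_univ, add_sub_cancel_right, ← ENNReal.log_inv]
  rw [ENNReal.log_pos_real (by simp) (by simpa using h0)]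
  rw [EReal.toENNReal_of_ne_top (EReal.coe_ne_top _), EReal.toReal_coe]

end KL

/-! ### The linear recursion behind both bounds -/

section Recursion

/-- Rests on `q (1 - q ^ t) + (1 - q) = 1 - q ^ (t + 1)`. It serves with `q = 1 - η` for the
induction over time steps and for the one over coordinates of a product channel. -/
theorem le_one_sub_pow_succ_mul {q x y D : ℝ≥0∞} {t : ℕ} (hq : q ≤ 1)
    (hx : x ≤ (1 - q ^ t) * D) (hy : y ≤ q * x + (1 - q) * D) :
    y ≤ (1 - q ^ (t + 1)) * D := by
  refine hy.trans ((add_le_add_left (mul_le_mul_right hx q) _).trans ?_)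
  rw [← mul_assoc, ← add_mul]
  refine mul_le_mul_left ?_ D
  have hqt : q ≠ ∞ := ne_top_of_le_ne_top ENNReal.one_ne_top hq
  rw [ENNReal.mul_sub (fun _ _ => hqt), mul_one, ← pow_succ']
  have h1 : q ^ (t + 1) ≤ q := by
    rw [pow_succ]; exact mul_le_of_le_one_left' (pow_le_one' hq t)
  rw [add_comm, tsub_add_tsub_cancel hq h1]

end Recursion

/-! ### The basic contraction step -/

section Step

variable {H X Y : Type*} [MeasurableSpace H] [MeasurableSpace X] [MeasurableSpace Y]

/-- Conditioning on the first coordinate, which is kept intact, splits both divergences by the chain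
rule. The marginal part is unchanged, and the conditional part shrinks by the SDPI constant for each
value of that coordinate. -/
theorem klDiv_parallelComp_le [Finite H] [MeasurableSingletonClass H] [Finite X]
    [MeasurableSingletonClass X] (K : Kernel X Y)
    [MeasurableSpace.CountableOrCountablyGenerated H Y]
    [IsMarkovKernel K] (P Q : Measure (H × X)) [IsProbabilityMeasure P]
    [IsProbabilityMeasure Q] (h : klDiv Q P ≠ ∞) :
    klDiv (Q.bind ((Kernel.id : Kernel H H) ∥ₖ K)) (P.bind ((Kernel.id : Kernel H H) ∥ₖ K)) ≤
      (1 - sdpiConst K) * klDiv Q.fst P.fst + sdpiConst K * klDiv Q P := by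
  have : Nonempty (H × X) := nonempty_of_isProbabilityMeasure P
  have : Nonempty X := this.map Prod.snd
  set q := Q.condKernel
  set p := P.condKernel
  have hQ : Q.fst ⊗ₘ q = Q := Q.disintegrate _
  have hP : P.fst ⊗ₘ p = P := P.disintegrate _
  have hac : Q.fst ⊗ₘ q ≪ P.fst ⊗ₘ p := by rw [hQ, hP]; exact (klDiv_ne_top_iff.1 h).1
  have hqp : ∀ᵐ a ∂Q.fst, q a ≪ p a := (Measure.absolutelyContinuous_compProd_iff'.1 hac).2
  have hqp' : ∀ᵐ a ∂Q.fst, (K ∘ₖ q) a ≪ (K ∘ₖ p) a := by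
    filter_upwards [hqp] with a ha
    rw [Kernel.comp_apply, Kernel.comp_apply]
    exact Measure.AbsolutelyContinuous.comp_right ha K
  have hQK : Q.bind ((Kernel.id : Kernel H H) ∥ₖ K) = Q.fst ⊗ₘ (K ∘ₖ q) := by
    rw [← Measure.parallelComp_comp_compProd, hQ]
  have hPK : P.bind ((Kernel.id : Kernel H H) ∥ₖ K) = P.fst ⊗ₘ (K ∘ₖ p) := by
    rw [← Measure.parallelComp_comp_compProd, hP]
  have hle : klDiv (Q.fst ⊗ₘ (K ∘ₖ q)) (Q.fst ⊗ₘ (K ∘ₖ p)) ≤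
      sdpiConst K * klDiv (Q.fst ⊗ₘ q) (Q.fst ⊗ₘ p) := by
    rw [klDiv_compProd_eq_lintegral _ _ _ hqp', klDiv_compProd_eq_lintegral _ _ _ hqp,
      ← lintegral_const_mul' _ _
        (ne_top_of_le_ne_top ENNReal.one_ne_top (sdpiConst_le_one K))]
    refine lintegral_mono_ae ?_
    filter_upwards [hqp] with a ha
    rw [Kernel.comp_apply, Kernel.comp_apply]
    exact klDiv_bind_le_sdpiConst_mul K (klDiv_ne_top_of_finite ha)
  have hD : klDiv Q P = klDiv Q.fst P.fst + klDiv (Q.fst ⊗ₘ q) (Q.fst ⊗ₘ p) := by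
    rw [← klDiv_compProd_eq_add, hQ, hP]
  -- The two multiples of the marginal divergence recombine to one copy, so no divergences are
  -- subtracted.
  rw [hQK, hPK, klDiv_compProd_eq_add, hD, mul_add, ← add_assoc, ← add_mul,
    tsub_add_cancel_of_le (sdpiConst_le_one K), one_mul]
  gcongr

end Step

/-! ### Contraction of product channels -/

/-- Shifting weight to the larger endpoint increases a convex combination; this lets the largest
SDPI constant replace an individual one. -/
theorem one_sub_mul_add_mul_mono {a b x D : ℝ≥0∞} (hab : a ≤ b) (hb : b ≤ 1) (hx : x ≤ D) :
    (1 - a) * x + a * D ≤ (1 - b) * x + b * D := by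
  obtain ⟨d, rfl⟩ := exists_add_of_le hx
  have h : ∀ c : ℝ≥0∞, c ≤ 1 → (1 - c) * x + c * (x + d) = x + c * d := fun c hc => by
    rw [mul_add, ← add_assoc, ← add_mul, tsub_add_cancel_of_le hc, one_mul]
  rw [h a (hab.trans hb), h b hb]
  gcongr

section Prod

variable {ι : Type*} [Fintype ι] {X Y : ι → Type*}
  [∀ i, Finite (X i)] [∀ i, MeasurableSpace (X i)] [∀ i, MeasurableSingletonClass (X i)]
  [∀ i, MeasurableSpace (Y i)]

theorem prodChannel_apply (K : ∀ i, Kernel (X i) (Y i)) (x : ∀ i, X i) :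
    prodChannel K x = Measure.pi fun i => K i (x i) := rfl

variable [∀ i, Finite (Y i)] [∀ i, MeasurableSingletonClass (Y i)]

/-- By independence of the coordinates, one may use the old channels everywhere and then overwrite
coordinate `i` by a fresh output of `k`. -/
theorem prodChannel_update_eq_map [DecidableEq ι] (K : ∀ i, Kernel (X i) (Y i))
    [∀ i, IsMarkovKernel (K i)] (i : ι) (k : Kernel (X i) (Y i)) [IsMarkovKernel k]
    (x : ∀ i, X i) :
    prodChannel (Function.update K i k) x =
      ((prodChannel K x).prod (k (x i))).map fun p => Function.update p.1 i p.2 := by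
  have hm : ∀ j, IsMarkovKernel (Function.update K i k j) := fun j => by
    rcases eq_or_ne j i with rfl | hj
    · simpa
    · rw [Function.update_of_ne hj]; infer_instance
  have hupd : Measurable fun p : (∀ i, Y i) × Y i => Function.update p.1 i p.2 :=
    measurable_of_finite _
  rw [prodChannel_apply]
  refine (Measure.pi_eq fun B hB => ?_)
  rw [Measure.map_apply hupd (.univ_pi hB)]
  have hpre : (fun p : (∀ i, Y i) × Y i => Function.update p.1 i p.2) ⁻¹' Set.univ.pi B =
      (Set.univ.pi (Function.update B i Set.univ)) ×ˢ B i := by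
    ext p
    simp only [Set.mem_preimage, Set.mem_univ_pi, Set.mem_prod]
    constructor
    · intro h
      refine ⟨fun j => ?_, by simpa using h i⟩
      rcases eq_or_ne j i with rfl | hj
      · simp
      · simpa [hj] using h j
    · rintro ⟨h, h'⟩ j
      rcases eq_or_ne j i with rfl | hj
      · simpa
      · simpa [hj] using h j
  rw [hpre, Measure.prod_prod, prodChannel_apply, Measure.pi_pi,
    Fintype.prod_eq_mul_prod_compl i, Fintype.prod_eq_mul_prod_compl i]
  simp only [Function.update_self, measure_univ, one_mul]
  rw [mul_comm]
  congr 1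
  refine Finset.prod_congr rfl fun j hj => ?_
  have hj : j ≠ i := by simpa using hj
  simp [hj]

theorem klDiv_bind_prodChannel_update_le [DecidableEq ι] (K : ∀ i, Kernel (X i) (Y i))
    [∀ i, IsMarkovKernel (K i)] (i : ι) (k : Kernel (X i) (Y i)) [IsMarkovKernel k]
    (P Q : Measure (∀ i, X i)) [IsProbabilityMeasure P] [IsProbabilityMeasure Q]
    (h : klDiv Q P ≠ ∞) :
    klDiv (Q.bind (prodChannel (Function.update K i k)))
        (P.bind (prodChannel (Function.update K i k))) ≤
      (1 - sdpiConst k) * klDiv (Q.bind (prodChannel K)) (P.bind (prodChannel K)) +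
        sdpiConst k * klDiv Q P := by
  have hev : Measurable fun x : ∀ i, X i => x i := measurable_pi_apply i
  -- The old outputs play the part of the retained coordinate in `klDiv_parallelComp_le`, and `x i`
  -- is the input of the new channel.
  set J : Kernel (∀ i, X i) ((∀ i, Y i) × X i) :=
    prodChannel K ×ₖ Kernel.deterministic (fun x => x i) hev
  have hupd : Measurable fun p : (∀ i, Y i) × Y i => Function.update p.1 i p.2 :=
    measurable_of_finite _
  have hJfst : ∀ R : Measure (∀ i, X i), (R.bind J).fst = R.bind (prodChannel K) := fun R => by
    rw [Measure.fst, ← Measure.deterministic_comp_eq_map measurable_fst, Measure.comp_assoc,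
      Kernel.deterministic_comp_eq_map, ← Kernel.fst_eq, Kernel.fst_prod]
  have hJ : prodChannel (Function.update K i k) =
      (((Kernel.id : Kernel (∀ i, Y i) (∀ i, Y i)) ∥ₖ k) ∘ₖ J).map
        fun p => Function.update p.1 i p.2 := by
    ext1 x
    rw [Kernel.parallelComp_comp_prod, Kernel.map_apply _ hupd, Kernel.prod_apply,
      prodChannel_update_eq_map, Kernel.id_comp, Kernel.comp_deterministic_eq_comap,
      Kernel.comap_apply]
  have hJb : ∀ R : Measure (∀ i, X i), R.bind (prodChannel (Function.update K i k)) =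
      ((R.bind J).bind ((Kernel.id : Kernel (∀ i, Y i) (∀ i, Y i)) ∥ₖ k)).map
        fun p => Function.update p.1 i p.2 := fun R => by
    rw [hJ, Measure.comp_assoc, ← Kernel.deterministic_comp_eq_map hupd, ← Measure.comp_assoc,
      Measure.deterministic_comp_eq_map]
  have hle : klDiv (Q.bind J) (P.bind J) ≤ klDiv Q P := klDiv_comp_right_le Q P J
  rw [hJb, hJb]
  refine (klDiv_map_le _ _ hupd).trans ((klDiv_parallelComp_le k _ _
    (ne_top_of_le_ne_top h hle)).trans ?_)
  rw [hJfst, hJfst]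
  gcongr

theorem sdpiConst_prodChannel_le (K : ∀ i, Kernel (X i) (Y i)) [∀ i, IsMarkovKernel (K i)] :
    sdpiConst (prodChannel K) ≤ 1 - (1 - ⨆ i, sdpiConst (K i)) ^ Fintype.card ι := by
  classical
  refine iSup_le fun P => iSup_le fun Q => iSup_le fun hP => iSup_le fun hQ => iSup_le fun _ =>
    iSup_le fun h => ENNReal.div_le_of_le_mul ?_
  obtain ⟨x₀⟩ : Nonempty (∀ i, X i) := nonempty_of_isProbabilityMeasure P
  have y₀ : ∀ i, Y i := fun i => (nonempty_of_isProbabilityMeasure (K i (x₀ i))).some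
  -- Outside `s` the channel is constant and conveys nothing, so the divergence is zero at `s = ∅`.
  let L : Finset ι → ∀ i, Kernel (X i) (Y i) := fun s i =>
    if i ∈ s then K i else Kernel.const _ (Measure.dirac (y₀ i))
  have hL : ∀ s i, IsMarkovKernel (L s i) := fun s i => by
    dsimp only [L]
    split_ifs <;> infer_instance
  have hη : (⨆ i, sdpiConst (K i)) ≤ 1 := iSup_le fun i => sdpiConst_le_one (K i)
  have key : ∀ s : Finset ι, klDiv (Q.bind (prodChannel (L s))) (P.bind (prodChannel (L s))) ≤
      (1 - (1 - ⨆ i, sdpiConst (K i)) ^ s.card) * klDiv Q P := by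
    intro s
    induction s using Finset.induction_on with
    | empty =>
      have hc : prodChannel (L ∅) = Kernel.const _ (Measure.pi fun i => Measure.dirac (y₀ i)) := by
        ext1 x
        simp [prodChannel_apply, L]
      simp [hc]
    | insert i s hi ih =>
      have hup : L (insert i s) = Function.update (L s) i (K i) := by
        funext j
        rcases eq_or_ne j i with rfl | hj
        · simp [L]
        · simp [L, hj]
      rw [Finset.card_insert_of_notMem hi, hup]
      refine le_one_sub_pow_succ_mul tsub_le_self ih
        ((klDiv_bind_prodChannel_update_le (L s) i (K i) P Q h).trans ?_)
      rw [ENNReal.sub_sub_cancel ENNReal.one_ne_top hη]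
      exact one_sub_mul_add_mul_mono (le_iSup (fun i => sdpiConst (K i)) i) hη
        (klDiv_comp_right_le Q P _)
  have huniv : L Finset.univ = K := by
    funext i
    simp [L]
  simpa [huniv] using key Finset.univ

end Prod

/-! ### Evolution of the history of a node -/

theorem map_pi_comp_injective {ι ι' : Type*} [Fintype ι] [Fintype ι'] {Y : ι → Type*}
    [∀ i, MeasurableSpace (Y i)] (μ : ∀ i, Measure (Y i)) [∀ i, IsProbabilityMeasure (μ i)]
    {g : ι' → ι} (hg : Function.Injective g) :
    (Measure.pi μ).map (fun y j => y (g j)) = Measure.pi fun j => μ (g j) := by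
  have h := (iIndepFun_pi (μ := μ) (X := fun i (y : Y i) => y)
    (fun i => aemeasurable_id)).precomp hg
  rw [iIndepFun_iff_map_fun_eq_pi_map (fun j => (measurable_pi_apply (g j)).aemeasurable)] at h
  rw [h]
  congr with j : 1
  exact (measurePreserving_eval μ (g j)).map_eq

theorem received_snoc {V : Type*} {E : Finset (V × V)} {Y : E → Type*} {t : ℕ} (v : V)
    (y : Fin t → ∀ e, Y e) (z : ∀ e, Y e) :
    received v (Fin.snoc y z : Fin (t + 1) → ∀ e, Y e) =
      Fin.snoc (received v y) (fun e : {e : E // e.1.2 = v} => z e.1) := by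
  funext s
  refine Fin.lastCases ?_ (fun j => ?_) s <;> funext e <;> simp [received]

namespace Algorithm

variable {V : Type*} {E : Finset (V × V)} {W : V → Type*} {X Y : E → Type*}
  {Z : Type*} {T : ℕ}
  [∀ v, MeasurableSpace (W v)] [∀ e, MeasurableSpace (X e)] [∀ e, MeasurableSpace (Y e)]
  [MeasurableSpace Z]

theorem inputs_eq_encode (A : Algorithm E W X Y Z T) {t : ℕ} (h : t < T)
    (p : (∀ v, W v) × (Fin t → ∀ e, Y e)) {v : V} (e : E) (he : e.1.1 = v) :
    A.inputs t h p e = A.encode v ⟨t, h⟩ (p.1 v, received v p.2) ⟨e, he⟩ := by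
  subst he
  rfl

variable [DecidableEq V]

/-- The history of node `v`, together with the inputs to the edges that enter `v` from another
node. -/
def historyInputs (A : Algorithm E W X Y Z T) (v : V) (t : ℕ) (h : t < T)
    (p : (∀ v, W v) × (Fin t → ∀ e, Y e)) :
    (Fin t → InMsg Y v) × (∀ e : Cutset E {v}, X e.1) :=
  (received v p.2, fun e => A.inputs t h p e.1)

theorem measurable_historyInputs (A : Algorithm E W X Y Z T) (v : V) (t : ℕ) (h : t < T) :
    Measurable (A.historyInputs v t h) :=
  ((measurable_received v).comp measurable_snd).prodMk <| measurable_pi_lambda _ fun e =>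
    (measurable_pi_apply e.1).comp (A.measurable_inputs t h)

variable [∀ e, Finite (X e)] [∀ e, MeasurableSingletonClass (X e)]

/-- The conditional law of the history of node `v`, given the observations. -/
noncomputable def historyKernel (A : Algorithm E W X Y Z T) (K : ∀ e, Kernel (X e) (Y e)) (v : V)
    (t : ℕ) (h : t ≤ T) : Kernel (∀ v, W v) (Fin t → InMsg Y v) :=
  (A.outputs K t h).map (received v)

/-- The conditional law of the history of node `v` and of the inputs to the edges that enter `v`
from another node, given the observations. -/
noncomputable def historyInputsKernel (A : Algorithm E W X Y Z T) (K : ∀ e, Kernel (X e) (Y e))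
    (v : V) (t : ℕ) (h : t < T) :
    Kernel (∀ v, W v) ((Fin t → InMsg Y v) × (∀ e : Cutset E {v}, X e.1)) :=
  (Kernel.id ×ₖ A.outputs K t h.le).map (A.historyInputs v t h)

instance (A : Algorithm E W X Y Z T) (K : ∀ e, Kernel (X e) (Y e)) [∀ e, IsMarkovKernel (K e)]
    (v : V) (t : ℕ) (h : t ≤ T) : IsMarkovKernel (A.historyKernel K v t h) :=
  Kernel.IsMarkovKernel.map _ (measurable_received v)

instance (A : Algorithm E W X Y Z T) (K : ∀ e, Kernel (X e) (Y e)) [∀ e, IsMarkovKernel (K e)]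
    (v : V) (t : ℕ) (h : t < T) : IsMarkovKernel (A.historyInputsKernel K v t h) :=
  Kernel.IsMarkovKernel.map _ (A.measurable_historyInputs v t h)

theorem fst_historyInputsKernel (A : Algorithm E W X Y Z T) (K : ∀ e, Kernel (X e) (Y e))
    [∀ e, IsMarkovKernel (K e)] (v : V) (t : ℕ) (h : t < T) :
    (A.historyInputsKernel K v t h).fst = A.historyKernel K v t h.le := by
  have hc : Prod.fst ∘ A.historyInputs v t h = received v ∘ Prod.snd := rfl
  rw [Kernel.fst_eq, historyInputsKernel, historyKernel,
    ← Kernel.map_comp_right _ (A.measurable_historyInputs v t h) measurable_fst, hc,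
    Kernel.map_comp_right _ measurable_snd (measurable_received v), ← Kernel.snd_eq,
    Kernel.snd_prod]

variable [∀ e, Finite (Y e)] [∀ e, MeasurableSingletonClass (Y e)]

/-- Assemble the messages received by `v` from those sent by other nodes and those sent by `v`. -/
def assemble (v : V) (p : (∀ e : Cutset E {v}, Y e.1) ×
    (∀ e : {e : {e : E // e.1.2 = v} // ¬ e.1.1.1 ∉ ({v} : Finset V)}, Y e.1.1)) : InMsg Y v :=
  (MeasurableEquiv.piEquivPiSubtypeProd (fun e : {e : E // e.1.2 = v} => Y e.1)
    fun e => e.1.1.1 ∉ ({v} : Finset V)).symm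
    (fun e => p.1 ⟨e.1.1, e.2, Finset.mem_singleton.2 e.1.2⟩, p.2)

theorem map_assemble (v : V) (μ : ∀ e, Measure (Y e)) [∀ e, IsProbabilityMeasure (μ e)] :
    ((Measure.pi fun e : Cutset E {v} => μ e.1).prod
      (Measure.pi fun e : {e : {e : E // e.1.2 = v} // ¬ e.1.1.1 ∉ ({v} : Finset V)} =>
        μ e.1.1)).map (assemble v) = Measure.pi fun e : {e : E // e.1.2 = v} => μ e.1 := by
  have h1 := (measurePreserving_piEquivPiSubtypeProd
    (fun e : {e : E // e.1.2 = v} => μ e.1) fun e => e.1.1.1 ∉ ({v} : Finset V)).symm.map_eq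
  rw [← h1]
  have hg : Function.Injective
      fun e : {e : {e : E // e.1.2 = v} // e.1.1.1 ∉ ({v} : Finset V)} =>
        (⟨e.1.1, e.2, Finset.mem_singleton.2 e.1.2⟩ : Cutset E {v}) := fun a b hab => by
    have := congrArg Subtype.val hab
    exact Subtype.ext (Subtype.ext this)
  have h2 := map_pi_comp_injective (fun e : Cutset E {v} => μ e.1) hg
  rw [← h2, ← Measure.map_id (μ := Measure.pi fun e :
    {e : {e : E // e.1.2 = v} // ¬ e.1.1.1 ∉ ({v} : Finset V)} => μ e.1.1),
    Measure.map_prod_map _ _ (measurable_of_finite _) measurable_id, Measure.map_id,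
    Measure.map_map (MeasurableEquiv.measurable _) (measurable_of_finite _)]
  rfl

/-- The next history of a node `v` that observes `w₀`, given its present history and the messages
that it receives from other nodes. -/
noncomputable def extendHistory (A : Algorithm E W X Y Z T) (K : ∀ e, Kernel (X e) (Y e)) (v : V)
    (t : ℕ) (h : t < T) (w₀ : W v) :
    Kernel ((Fin t → InMsg Y v) × (∀ e : Cutset E {v}, Y e.1)) (Fin (t + 1) → InMsg Y v) :=
  Kernel.ofFunOfCountable fun p =>
    (Measure.pi fun e : {e : {e : E // e.1.2 = v} // ¬ e.1.1.1 ∉ ({v} : Finset V)} =>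
      K e.1.1 (A.encode v ⟨t, h⟩ (w₀, p.1) ⟨e.1.1, by simpa using e.2⟩)).map
      fun y => Fin.snoc p.1 (assemble v (p.2, y))

instance (A : Algorithm E W X Y Z T) (K : ∀ e, Kernel (X e) (Y e)) [∀ e, IsMarkovKernel (K e)]
    (v : V) (t : ℕ) (h : t < T) (w₀ : W v) : IsMarkovKernel (A.extendHistory K v t h w₀) :=
  ⟨fun _ => Measure.isProbabilityMeasure_map (measurable_of_finite _).aemeasurable⟩

/-- Given the past, outputs on distinct edges are independent. The edges into `v` are those of the
cutset of `{v}` and possibly a self-loop, whose input is determined by `w v` and the history; hence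
the post-processing depends on `w` only through `w v`. -/
theorem bind_extendHistory (A : Algorithm E W X Y Z T) (K : ∀ e, Kernel (X e) (Y e))
    [∀ e, IsMarkovKernel (K e)] (v : V) (t : ℕ) (h : t < T) (w : ∀ v, W v)
    (y : Fin t → ∀ e, Y e) :
    ((((Kernel.id : Kernel (Fin t → InMsg Y v) _) ∥ₖ cutsetChannel K {v})
      (A.historyInputs v t h (w, y))).bind (A.extendHistory K v t h (w v))) =
      (A.step K t h (w, y)).map fun z => received v (Fin.snoc y z : Fin (t + 1) → ∀ e, Y e) := by
  set x := A.inputs t h (w, y) with hx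
  have hstep : A.step K t h (w, y) = Measure.pi fun e => K e (x e) := rfl
  have hrec : (fun z : ∀ e, Y e => received v (Fin.snoc y z : Fin (t + 1) → ∀ e, Y e)) =
      (fun z : InMsg Y v => (Fin.snoc (received v y) z : Fin (t + 1) → InMsg Y v)) ∘
        fun z e => z e.1 := by
    funext z
    exact received_snoc v y z
  rw [hrec, ← Measure.map_map (measurable_of_finite _) (measurable_of_finite _), hstep,
    map_pi_comp_injective (fun e => K e (x e)) Subtype.val_injective,
    ← map_assemble v (fun e => K e (x e)),
    Measure.map_map (measurable_of_finite _) (measurable_of_finite _)]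
  ext s hs
  rw [Measure.bind_apply hs (Kernel.aemeasurable _), Kernel.parallelComp_apply, Kernel.id_apply,
    Measure.map_apply (measurable_of_finite _) hs, Measure.prod_apply (Set.toFinite _).measurableSet,
    lintegral_prod _ (measurable_of_finite _).aemeasurable, lintegral_dirac]
  refine lintegral_congr fun yc => ?_
  change Measure.map _ _ _ = _
  rw [Measure.map_apply (measurable_of_finite _) hs]
  have he : ∀ e : {e : {e : E // e.1.2 = v} // ¬ e.1.1.1 ∉ ({v} : Finset V)},
      x e.1.1 = A.encode v ⟨t, h⟩ (w v, received v y) ⟨e.1.1, by simpa using e.2⟩ := fun e =>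
    A.inputs_eq_encode h (w, y) e.1.1 _
  simp only [he]
  rfl

theorem historyKernel_succ (A : Algorithm E W X Y Z T) (K : ∀ e, Kernel (X e) (Y e))
    [∀ e, IsMarkovKernel (K e)] (v : V) (t : ℕ) (h : t < T) (w : ∀ v, W v) :
    A.historyKernel K v (t + 1) h w =
      ((A.extendHistory K v t h (w v)) ∘ₖ
        ((Kernel.id : Kernel (Fin t → InMsg Y v) _) ∥ₖ cutsetChannel K {v}) ∘ₖ
          (A.historyInputsKernel K v t h)) w := by
  rw [historyKernel, outputs, ← Kernel.map_comp_right _ (measurable_snoc t) (measurable_received v),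
    Kernel.comp_apply, historyInputsKernel, Kernel.map_apply _ (A.measurable_historyInputs v t h)]
  have hm : Measurable (received v ∘ fun p : (Fin t → ∀ e, Y e) × (∀ e, Y e) =>
      (Fin.snoc p.1 p.2 : Fin (t + 1) → ∀ e, Y e)) := measurable_of_finite _
  ext s hs
  rw [Kernel.map_apply' _ hm _ hs, Kernel.compProd_apply (hm hs),
    Measure.bind_apply hs (Kernel.aemeasurable _),
    lintegral_map (Kernel.measurable_coe _ hs) (A.measurable_historyInputs v t h),
    Kernel.prod_apply, Kernel.id_apply, lintegral_prod, lintegral_dirac']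
  · refine lintegral_congr fun y => ?_
    rw [Kernel.comp_apply, bind_extendHistory, Measure.map_apply (measurable_of_finite _) hs]
    rfl
  · exact Measurable.lintegral_prod_right'
      ((Kernel.measurable_coe _ hs).comp (A.measurable_historyInputs v t h))
  · exact ((Kernel.measurable_coe _ hs).comp (A.measurable_historyInputs v t h)).aemeasurable

/-- Contraction of relative entropy along a run of an algorithm. -/
theorem klDiv_bind_historyKernel_le (A : Algorithm E W X Y Z T) (K : ∀ e, Kernel (X e) (Y e))
    [∀ e, IsMarkovKernel (K e)] (v : V) (w₀ : W v) (ρ ρ' : Measure (∀ v, W v))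
    [IsProbabilityMeasure ρ] [IsProbabilityMeasure ρ'] (hρ : ∀ᵐ w ∂ρ, w v = w₀)
    (hρ' : ∀ᵐ w ∂ρ', w v = w₀)
    (hac : ∀ t (h : t < T),
      ρ'.bind (A.historyInputsKernel K v t h) ≪ ρ.bind (A.historyInputsKernel K v t h))
    (t : ℕ) (h : t ≤ T) :
    klDiv (ρ'.bind (A.historyKernel K v t h)) (ρ.bind (A.historyKernel K v t h)) ≤
      (1 - (1 - sdpiConst (cutsetChannel K {v})) ^ t) * klDiv ρ' ρ := by
  induction t with
  | zero =>
    -- The empty history takes a single value, so the recursion starts from zero divergence.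
    have h0 : A.historyKernel K v 0 h = Kernel.const _ (Measure.dirac fun i => i.elim0) := by
      ext1 w
      rw [historyKernel, outputs, Kernel.map_apply _ (measurable_received v), Kernel.const_apply,
        Kernel.const_apply, Measure.map_dirac']
      swap; · exact measurable_received v
      congr 1
      exact Subsingleton.elim _ _
    simp [h0]
  | succ t ih =>
    -- Since `v` observes `w₀` under both laws, one and the same post-processing kernel serves both,
    -- and data processing discards it.
    have hsucc : ∀ r : Measure (∀ v, W v), (∀ᵐ w ∂r, w v = w₀) →
        r.bind (A.historyKernel K v (t + 1) h) = ((r.bind (A.historyInputsKernel K v t h)).bind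
          ((Kernel.id : Kernel (Fin t → InMsg Y v) _) ∥ₖ cutsetChannel K {v})).bind
            (A.extendHistory K v t h w₀) := fun r hr => by
      rw [Measure.comp_assoc, Measure.comp_assoc]
      refine Measure.bind_congr_right ?_
      filter_upwards [hr] with w hw
      rw [historyKernel_succ, hw, Kernel.comp_assoc]
    have hfst : ∀ r : Measure (∀ v, W v), (r.bind (A.historyInputsKernel K v t h)).fst =
        r.bind (A.historyKernel K v t (Nat.le_of_succ_le h)) := fun r => by
      rw [← A.fst_historyInputsKernel K v t h, Measure.fst,
        ← Measure.deterministic_comp_eq_map measurable_fst, Measure.comp_assoc,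
        Kernel.deterministic_comp_eq_map, ← Kernel.fst_eq]
    rw [hsucc ρ hρ, hsucc ρ' hρ']
    -- History and inputs live on a finite alphabet, so `hac` gives the finiteness needed here even
    -- when `klDiv ρ' ρ = ∞`.
    refine le_one_sub_pow_succ_mul tsub_le_self (ih (Nat.le_of_succ_le h))
      ((klDiv_comp_right_le _ _ _).trans ((klDiv_parallelComp_le (cutsetChannel K {v}) _ _
        (klDiv_ne_top_of_finite (hac t h))).trans ?_))
    rw [ENNReal.sub_sub_cancel ENNReal.one_ne_top (sdpiConst_le_one _), hfst, hfst]
    gcongr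
    exact klDiv_comp_right_le _ _ _

end Algorithm

/-! ### Conditional mutual information through a channel -/

section CondMutualInfo

variable {α β γ ζ ζ' : Type*} [MeasurableSpace α] [MeasurableSpace β] [MeasurableSpace γ]
  [MeasurableSpace ζ] [MeasurableSpace ζ']

/-- A measurable minorant attains the left-hand integral, and Tonelli applies to it. This half of
Tonelli thus requires no measurability of `F`, which is later a relative entropy depending on a
parameter. -/
theorem lintegral_compProd_le (μ : Measure γ) [SFinite μ] (κ : Kernel γ α) [IsSFiniteKernel κ]
    (F : γ × α → ℝ≥0∞) : ∫⁻ p, F p ∂(μ ⊗ₘ κ) ≤ ∫⁻ c, ∫⁻ a, F (c, a) ∂(κ c) ∂μ := by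
  obtain ⟨G, hG, hGF, hint⟩ := exists_measurable_le_lintegral_eq (μ ⊗ₘ κ) F
  rw [hint, Measure.lintegral_compProd hG]
  exact lintegral_mono fun c => lintegral_mono fun a => hGF (c, a)

theorem compProd_map_id_prod (μ : Measure γ) [SFinite μ] (κ : Kernel γ α) [IsSFiniteKernel κ]
    {g : γ × α → ζ} (hg : Measurable g) :
    μ ⊗ₘ ((Kernel.id ×ₖ κ).map g) = (μ ⊗ₘ κ).map fun p => (p.1, g p) := by
  have hm : Measurable fun p : γ × α => (p.1, g p) := measurable_fst.prodMk hg
  ext s hs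
  rw [Measure.compProd_apply hs, Measure.map_apply hm hs, Measure.compProd_apply (hm hs)]
  refine lintegral_congr fun c => ?_
  have hsc : MeasurableSet (Prod.mk c ⁻¹' s) := measurable_prodMk_left hs
  rw [Kernel.map_apply' _ hg _ hsc, Kernel.prod_apply, Kernel.id_apply, Measure.dirac_prod,
    Measure.map_apply measurable_prodMk_left (hg hsc)]
  rfl

theorem compProd_comp_id_prod (μ : Measure γ) [SFinite μ] (κ : Kernel γ α) [IsSFiniteKernel κ]
    (N : Kernel (γ × α) β) [IsSFiniteKernel N] :
    μ ⊗ₘ (N ∘ₖ (Kernel.id ×ₖ κ)) = ((μ ⊗ₘ κ) ⊗ₘ N).map fun p => (p.1.1, p.2) := by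
  have hm : Measurable fun p : (γ × α) × β => (p.1.1, p.2) := by fun_prop
  ext s hs
  rw [Measure.compProd_apply hs, Measure.map_apply hm hs, Measure.compProd_apply (hm hs),
    Measure.lintegral_compProd (Kernel.measurable_kernel_prodMk_left (hm hs))]
  refine lintegral_congr fun c => ?_
  have hsc : MeasurableSet (Prod.mk c ⁻¹' s) := measurable_prodMk_left hs
  rw [Kernel.comp_apply' _ _ _ hsc, Kernel.prod_apply, Kernel.id_apply, Measure.dirac_prod,
    lintegral_map (Kernel.measurable_coe _ hsc) measurable_prodMk_left]
  rfl

/-- Exhibits a conditionally independent law as an image under the map that also produces the true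
joint law, so that data processing compares the two. -/
theorem compProd_prod_map (μ : Measure γ) [SFinite μ] (κ : Kernel γ α) [IsSFiniteKernel κ]
    (η : Kernel γ β) [IsSFiniteKernel η] {f : γ × α → ζ} (hf : Measurable f) {g : γ × β → ζ'}
    (hg : Measurable g) :
    μ ⊗ₘ (((Kernel.id ×ₖ κ).map f) ×ₖ ((Kernel.id ×ₖ η).map g)) =
      ((μ ⊗ₘ κ) ⊗ₘ (η.comap Prod.fst measurable_fst)).map
        fun p => (p.1.1, (f p.1, g (p.1.1, p.2))) := by
  have hm : Measurable fun p : (γ × α) × β => (p.1.1, (f p.1, g (p.1.1, p.2))) := by fun_prop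
  ext s hs
  rw [Measure.compProd_apply hs, Measure.map_apply hm hs, Measure.compProd_apply (hm hs),
    Measure.lintegral_compProd (Kernel.measurable_kernel_prodMk_left (hm hs))]
  refine lintegral_congr fun c => ?_
  have hsc : MeasurableSet (Prod.mk c ⁻¹' s) := measurable_prodMk_left hs
  have hfc : Measurable fun a => f (c, a) := hf.comp measurable_prodMk_left
  have hgc : Measurable fun b => g (c, b) := hg.comp measurable_prodMk_left
  have h1 : ((Kernel.id ×ₖ κ).map f) c = (κ c).map fun a => f (c, a) := by
    rw [Kernel.map_apply _ hf, Kernel.prod_apply, Kernel.id_apply, Measure.dirac_prod,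
      Measure.map_map hf measurable_prodMk_left]
    rfl
  have h2 : ((Kernel.id ×ₖ η).map g) c = (η c).map fun b => g (c, b) := by
    rw [Kernel.map_apply _ hg, Kernel.prod_apply, Kernel.id_apply, Measure.dirac_prod,
      Measure.map_map hg measurable_prodMk_left]
    rfl
  rw [Kernel.prod_apply, h1, h2, Measure.map_prod_map _ _ hfc hgc,
    Measure.map_apply (hfc.prodMap hgc) hsc, Measure.prod_apply ((hfc.prodMap hgc) hsc)]
  rfl

variable [StandardBorelSpace α] [Nonempty α] [Countable β] [MeasurableSingletonClass β]
  [StandardBorelSpace ζ] [Nonempty ζ] [StandardBorelSpace ζ'] [Nonempty ζ']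

/-- Data processing removes `f` and `g`. What remains is the divergence of the law of `(C, A, B)`
from the one where `B` is redrawn given `C` alone, that is, from the mixture of the `N (c, a)` over
`a`. -/
theorem condMutualInfo_le_lintegral {Ω : Type*} [MeasurableSpace Ω] (P : Measure Ω)
    [IsProbabilityMeasure P] {A : Ω → α} (hA : Measurable A) {B : Ω → β} (hB : Measurable B)
    {C : Ω → γ} (hC : Measurable C) (N : Kernel (γ × α) β) [IsMarkovKernel N]
    (hN : P.map (fun ω => ((C ω, A ω), B ω)) = P.map (fun ω => (C ω, A ω)) ⊗ₘ N)
    {f : γ × α → ζ} (hf : Measurable f) {g : γ × β → ζ'} (hg : Measurable g) :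
    condMutualInfo (fun ω => f (C ω, A ω)) (fun ω => g (C ω, B ω)) C P ≤
      (∫⁻ c, ∫⁻ a, klDiv (N (c, a)) ((condDistrib A C P c).bind fun a => N (c, a))
        ∂(condDistrib A C P c) ∂(P.map C)) / ENNReal.ofReal (Real.log 2) := by
  refine ENNReal.div_le_div_right ?_ _
  have : IsProbabilityMeasure (P.map C) := Measure.isProbabilityMeasure_map hC.aemeasurable
  set κ := condDistrib A C P with hκ
  set M : Kernel γ β := N ∘ₖ (Kernel.id ×ₖ κ) with hM
  have hMc : ∀ c, M c = (κ c).bind fun a => N (c, a) := fun c => by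
    rw [hM, Kernel.comp_apply, Kernel.prod_apply, Kernel.id_apply, Measure.dirac_prod]
    change _ = (κ c).bind (N.comap (Prod.mk c) measurable_prodMk_left)
    ext s hs
    rw [Measure.bind_apply hs N.aemeasurable, Measure.bind_apply hs
      (N.comap (Prod.mk c) measurable_prodMk_left).aemeasurable,
      lintegral_map (Kernel.measurable_coe _ hs) measurable_prodMk_left]
    rfl
  have hCA : P.map C ⊗ₘ κ = P.map fun ω => (C ω, A ω) := compProd_map_condDistrib hA.aemeasurable
  have hm : Measurable fun p : (γ × α) × β => (p.1.1, (f p.1, g (p.1.1, p.2))) := by fun_prop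
  have hjoint : P.map (fun ω => (C ω, (f (C ω, A ω), g (C ω, B ω)))) =
      ((P.map C ⊗ₘ κ) ⊗ₘ N).map fun p => (p.1.1, (f p.1, g (p.1.1, p.2))) := by
    rw [hCA, ← hN, Measure.map_map hm ((hC.prodMk hA).prodMk hB)]
    rfl
  have hf' : condDistrib (fun ω => f (C ω, A ω)) C P =ᵐ[P.map C] (Kernel.id ×ₖ κ).map f := by
    have := Kernel.IsMarkovKernel.map (Kernel.id ×ₖ κ) hf
    refine condDistrib_ae_eq_of_measure_eq_compProd C (by fun_prop) ?_
    rw [compProd_map_id_prod _ _ hf, hCA,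
      Measure.map_map (measurable_fst.prodMk hf) (hC.prodMk hA)]
    rfl
  have hCB : P.map C ⊗ₘ M = P.map fun ω => (C ω, B ω) := by
    rw [hM, compProd_comp_id_prod, hCA, ← hN,
      Measure.map_map (by fun_prop) ((hC.prodMk hA).prodMk hB)]
    rfl
  have hg' : condDistrib (fun ω => g (C ω, B ω)) C P =ᵐ[P.map C] (Kernel.id ×ₖ M).map g := by
    have := Kernel.IsMarkovKernel.map (Kernel.id ×ₖ M) hg
    refine condDistrib_ae_eq_of_measure_eq_compProd C (by fun_prop) ?_
    rw [compProd_map_id_prod _ _ hg, hCB,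
      Measure.map_map (measurable_fst.prodMk hg) (hC.prodMk hB)]
    rfl
  have hprod : P.map C ⊗ₘ (condDistrib (fun ω => f (C ω, A ω)) C P ×ₖ
      condDistrib (fun ω => g (C ω, B ω)) C P) =
      ((P.map C ⊗ₘ κ) ⊗ₘ (M.comap Prod.fst measurable_fst)).map
        fun p => (p.1.1, (f p.1, g (p.1.1, p.2))) := by
    have := Kernel.IsMarkovKernel.map (Kernel.id ×ₖ κ) hf
    have := Kernel.IsMarkovKernel.map (Kernel.id ×ₖ M) hg
    rw [← compProd_prod_map _ _ _ hf hg]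
    refine Measure.compProd_congr ?_
    filter_upwards [hf', hg'] with c h1 h2
    rw [Kernel.prod_apply, Kernel.prod_apply, h1, h2]
  rw [hjoint, hprod]
  refine (klDiv_map_le _ _ hm).trans ?_
  have hac' : ∀ c, ∀ᵐ a ∂(κ c), N (c, a) ≪ M c := fun c => by
    rw [hMc]
    exact ae_absolutelyContinuous_bind (κ c) (N.comap (Prod.mk c) measurable_prodMk_left)
  have hac : ∀ᵐ p ∂(P.map C ⊗ₘ κ),
      N p ≪ (M.comap Prod.fst measurable_fst : Kernel (γ × α) β) p := by
    rw [Measure.ae_compProd_iff (Kernel.measurableSet_absolutelyContinuous _ _)]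
    exact .of_forall hac'
  rw [klDiv_compProd_eq_lintegral _ _ _ hac]
  refine (lintegral_compProd_le _ _ _).trans ?_
  simp only [Kernel.comap_apply, hMc]
  exact le_rfl

end CondMutualInfo

/-! ### Splitting the observations -/

theorem bind_comap {α β γ : Type*} [MeasurableSpace α] [MeasurableSpace β] [MeasurableSpace γ]
    (ν : Measure α) {g : α → β} (hg : Measurable g) (N : Kernel β γ) :
    ν.bind (N.comap g hg) = (ν.map g).bind N := by
  rw [← Kernel.comp_deterministic_eq_comap, ← Measure.comp_assoc,
    Measure.deterministic_comp_eq_map]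

section Merge

variable {V : Type*} {W : V → Type*}

theorem measurable_observations {Ω' : Type*} [MeasurableSpace Ω'] [∀ v, MeasurableSpace (W v)]
    (S : Finset V) :
    Measurable (observations S : (∀ v, W v) × Ω' → ∀ u : S, W u) := by
  unfold observations
  fun_prop

variable [Fintype V] [DecidableEq V]

/-- All the observations, from those in `S` and those outside `S`. -/
def mergeObservations (S : Finset V) (p : (∀ u : S, W u) × (∀ u : (Sᶜ : Finset V), W u)) (u : V) :
    W u :=
  if h : u ∈ S then p.1 ⟨u, h⟩ else p.2 ⟨u, Finset.mem_compl.2 h⟩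

theorem measurable_mergeObservations [∀ v, MeasurableSpace (W v)] (S : Finset V) :
    Measurable (mergeObservations S :
      (∀ u : S, W u) × (∀ u : (Sᶜ : Finset V), W u) → ∀ u, W u) := by
  refine measurable_pi_lambda _ fun u => ?_
  unfold mergeObservations
  by_cases h : u ∈ S
  · simp only [h, dite_true]; fun_prop
  · simp only [h, dite_false]; fun_prop

theorem mergeObservations_of_mem {S : Finset V} {u : V} (h : u ∈ S)
    (p : (∀ u : S, W u) × (∀ u : (Sᶜ : Finset V), W u)) :
    mergeObservations S p u = p.1 ⟨u, h⟩ := dif_pos h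

theorem mergeObservations_observations {Ω' : Type*} (S : Finset V) (ω : (∀ v, W v) × Ω') :
    mergeObservations S (observations S ω, observations Sᶜ ω) = ω.1 := by
  funext u
  by_cases h : u ∈ S <;> simp [mergeObservations, observations, h]

end Merge

/-! ### The bound for a run of an algorithm -/

section Main

variable {V : Type*} [Fintype V] [DecidableEq V] {E : Finset (V × V)} {X Y : E → Type*}
  [∀ e, Finite (X e)] [∀ e, MeasurableSpace (X e)] [∀ e, MeasurableSingletonClass (X e)]
  [∀ e, MeasurableSpace (Y e)]
  (K : ∀ e, Kernel (X e) (Y e)) [∀ e, IsMarkovKernel (K e)]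
  {W : V → Type*} [∀ v, MeasurableSpace (W v)]
  {Z : Type*} [MeasurableSpace Z] {T : ℕ} (A : Algorithm E W X Y Z T)

/-- Provides the channel from the observations to the history of `v` to which
`condMutualInfo_le_lintegral` is applied. -/
theorem map_law_received (PW : Measure (∀ v, W v)) [IsProbabilityMeasure PW] (S : Finset V)
    (v : V) :
    (A.law K PW).map (fun ω => ((observations S ω, observations Sᶜ ω), received v ω.2)) =
      (A.law K PW).map (fun ω => (observations S ω, observations Sᶜ ω)) ⊗ₘ
        (A.historyKernel K v T le_rfl).comap _ (measurable_mergeObservations S) := by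
  have ho : Measurable fun w : ∀ v, W v => (observations S (w, ()), observations Sᶜ (w, ())) :=
    ((measurable_observations S).prodMk (measurable_observations Sᶜ)).comp
      measurable_prodMk_right
  have hr : Measurable (received v : (Fin T → ∀ e, Y e) → Fin T → InMsg Y v) :=
    Algorithm.measurable_received v
  have hfst : (A.law K PW).map (fun ω => (observations S ω, observations Sᶜ ω)) =
      PW.map fun w => (observations S (w, ()), observations Sᶜ (w, ())) := by
    conv_rhs => rw [← Measure.fst_compProd PW (A.outputs K T le_rfl), Measure.fst,
      Measure.map_map ho measurable_fst]
    rfl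
  have hm : Measurable fun ω : (∀ v, W v) × (Fin T → ∀ e, Y e) =>
      ((observations S ω, observations Sᶜ ω), received v ω.2) :=
    ((measurable_observations S).prodMk (measurable_observations Sᶜ)).prodMk
      (hr.comp measurable_snd)
  rw [hfst]
  ext s hs
  rw [Measure.map_apply hm hs, Algorithm.law, Measure.compProd_apply (hm hs),
    Measure.compProd_apply hs, lintegral_map (Kernel.measurable_kernel_prodMk_left hs) ho]
  refine lintegral_congr fun w => ?_
  rw [Kernel.comap_apply, mergeObservations_observations, Algorithm.historyKernel,
    Kernel.map_apply' _ hr _ (measurable_prodMk_left hs)]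
  rfl

variable [∀ e, Finite (Y e)] [∀ e, MeasurableSingletonClass (Y e)]
  [∀ v, StandardBorelSpace (W v)]

/-- For fixed observations of `S`, the relative entropy between the law of the history of a node
in `S` given the other observations, and its average over the other observations. -/
theorem ae_klDiv_historyKernel_le {S : Finset V} {v : V} (hv : v ∈ S) (c : ∀ u : S, W u)
    (ν : Measure (∀ u : (Sᶜ : Finset V), W u)) [IsProbabilityMeasure ν] :
    ∀ᵐ a ∂ν, klDiv (A.historyKernel K v T le_rfl (mergeObservations S (c, a)))
        (ν.bind fun a => A.historyKernel K v T le_rfl (mergeObservations S (c, a))) ≤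
      (1 - (1 - sdpiConst (cutsetChannel K {v})) ^ T) * (-(ENNReal.log (ν {a}))).toENNReal := by
  have hm : Measurable fun a => mergeObservations S (c, a) :=
    (measurable_mergeObservations S).comp measurable_prodMk_left
  -- Finitely many time steps, hence one null set of exceptional `a` for all of them.
  have hac : ∀ᵐ a ∂ν, ∀ t : Fin T,
      A.historyInputsKernel K v t t.2 (mergeObservations S (c, a)) ≪
        ν.bind ((A.historyInputsKernel K v t t.2).comap _ hm) := by
    rw [ae_all_iff]
    exact fun t => ae_absolutelyContinuous_bind ν ((A.historyInputsKernel K v t t.2).comap _ hm)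
  have : IsProbabilityMeasure (ν.map fun a => mergeObservations S (c, a)) :=
    Measure.isProbabilityMeasure_map hm.aemeasurable
  filter_upwards [hac] with a ha
  -- Membership of `v` in `S` makes its observation the same for all `a`, as the contraction
  -- requires.
  have hw : ∀ a, mergeObservations S (c, a) v = c ⟨v, hv⟩ := fun a =>
    mergeObservations_of_mem hv (c, a)
  have hset : MeasurableSet {w : ∀ v, W v | w v = c ⟨v, hv⟩} :=
    measurable_pi_apply v (measurableSet_singleton _)
  have h := A.klDiv_bind_historyKernel_le K v (c ⟨v, hv⟩)
    (ν.map fun a => mergeObservations S (c, a)) (Measure.dirac (mergeObservations S (c, a)))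
    ((ae_map_iff hm.aemeasurable hset).2 (.of_forall hw))
    ((ae_dirac_iff hset).2 (hw a))
    (fun t ht => by 
      rw [Measure.dirac_bind (Kernel.measurable _), ← bind_comap _ hm]
      exact ha ⟨t, ht⟩) T le_rfl
  rw [Measure.dirac_bind (Kernel.measurable _), ← bind_comap _ hm] at h
  refine h.trans ?_
  gcongr
  -- The two laws of all observations are the images of the point mass at `a` and of `ν` under one
  -- map.
  rw [← Measure.map_dirac' hm]
  exact (klDiv_map_le _ _ hm).trans (klDiv_dirac_le_neg_log ν a)

variable [∀ v, Nonempty (W v)] [StandardBorelSpace Z] [Nonempty Z]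

theorem condMutualInfo_finalEstimate_le (PW : Measure (∀ v, W v)) [IsProbabilityMeasure PW]
    {f : (∀ v, W v) → Z} (hf : Measurable f) {S : Finset V} {v : V} (hv : v ∈ S) :
    condMutualInfo (fun ω => f ω.1) (A.finalEstimate v) (observations S) (A.law K PW) ≤
      (1 - (1 - sdpiConst (cutsetChannel K {v})) ^ T) *
        condEntropy (observations Sᶜ) (observations S) (A.law K PW) := by
  have hZ : (fun ω : (∀ v, W v) × (Fin T → ∀ e, Y e) => f ω.1) =
      fun ω => (f ∘ mergeObservations S) (observations S ω, observations Sᶜ ω) := by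
    funext ω
    simp only [Function.comp_apply, mergeObservations_observations]
  -- As `v ∈ S`, the estimate is a function of `W_S` and the history of `v`.
  have hg : Measurable fun p : (∀ u : S, W u) × (Fin T → InMsg Y v) =>
      A.estimate v (p.1 ⟨v, hv⟩, p.2) := by
    have := A.measurable_estimate v
    fun_prop
  have hr : Measurable (received v : (Fin T → ∀ e, Y e) → Fin T → InMsg Y v) :=
    Algorithm.measurable_received v
  rw [hZ]
  refine (condMutualInfo_le_lintegral (A.law K PW) (measurable_observations Sᶜ)
    (hr.comp measurable_snd) (measurable_observations S) _ (map_law_received K A PW S v)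
    (hf.comp (measurable_mergeObservations S)) hg).trans ?_
  -- Finite constants can be moved across lower integrals without measurability of the integrand.
  have htop : (1 - (1 - sdpiConst (cutsetChannel K {v})) ^ T) ≠ ∞ :=
    ne_top_of_le_ne_top ENNReal.one_ne_top tsub_le_self
  have hlog : (ENNReal.ofReal (Real.log 2))⁻¹ ≠ ∞ := by
    simpa using Real.log_pos one_lt_two
  simp only [condEntropy, entropy, ENNReal.div_eq_inv_mul]
  rw [← lintegral_const_mul' _ _ hlog, ← lintegral_const_mul' _ _ htop]
  refine lintegral_mono fun c => ?_
  rw [lintegral_const_mul' _ _ hlog, mul_left_comm]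
  refine mul_le_mul_right ?_ _
  rw [← lintegral_const_mul' _ _ htop]
  exact lintegral_mono_ae (ae_klDiv_historyKernel_le K A hv c _)

end Main
end DistComp

open DistComp
theorem mainTheorem5 {V : Type*} [Fintype V] [DecidableEq V] (E : Finset (V × V))
    (X Y : E → Type*)
    [∀ e, Finite (X e)] [∀ e, MeasurableSpace (X e)] [∀ e, MeasurableSingletonClass (X e)]
    [∀ e, Finite (Y e)] [∀ e, MeasurableSpace (Y e)] [∀ e, MeasurableSingletonClass (Y e)]
    (K : ∀ e, Kernel (X e) (Y e)) [∀ e, IsMarkovKernel (K e)]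
    (W : V → Type*) [∀ v, MeasurableSpace (W v)] [∀ v, StandardBorelSpace (W v)]
    [∀ v, Nonempty (W v)]
    (Z : Type*) [MeasurableSpace Z] [StandardBorelSpace Z] [Nonempty Z]
    (PW : Measure (∀ v, W v)) [IsProbabilityMeasure PW]
    (f : (∀ v, W v) → Z) (hf : Measurable f)
    (T : ℕ) (A : Algorithm E W X Y Z T)
    (S : Finset V) (v : V) (hv : v ∈ S) :
    condMutualInfo (fun ω => f ω.1) (A.finalEstimate v) (observations S) (A.law K PW)
      ≤ (1 - (1 - sdpiConst (cutsetChannel K {v})) ^ T) *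
          condEntropy (observations Sᶜ) (observations S) (A.law K PW) ∧
    (1 - (1 - sdpiConst (cutsetChannel K {v})) ^ T) *
          condEntropy (observations Sᶜ) (observations S) (A.law K PW)
      ≤ (1 - (1 - ⨆ e : Cutset E {v}, sdpiConst (K e.1)) ^ (Fintype.card (Cutset E {v}) * T)) *
          condEntropy (observations Sᶜ) (observations S) (A.law K PW) := by
  refine ⟨condMutualInfo_finalEstimate_le K A PW hf hv, mul_le_mul_left ?_ _⟩
  have h := sdpiConst_prodChannel_le fun e : Cutset E {v} => K e.1
  -- With the exponent split, it suffices to compare the bases `(1 - η_v^*) ^ |E_v|` and `1 - η_v`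
  -- of the `T`-th powers.
  rw [pow_mul]
  refine tsub_le_tsub_left (pow_le_pow_left₀ zero_le ?_ T) 1
  exact ENNReal.le_sub_of_add_le_left
    (ne_top_of_le_ne_top ENNReal.one_ne_top (sdpiConst_le_one _))
    ((add_le_add_left h _).trans (tsub_add_cancel_of_le (pow_le_one' tsub_le_self _)).le)
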